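/- Let $U:\mathbb R\to\mathbb R$ be a smooth skew periodic potential, i.e. $U(x)=\tilde U(x)-\bar b x$ with $\tilde U$ smooth and $1$-periodic and $\bar b\in\mathbb R$. Assume that, for some $k\ge 1$, the critical points of $U$ are exactly the points $x_i, x_{i+\frac12}$, $i\in\mathbb Z$, where $x_i<x_{i+\frac12}<x_{i+1}$, $x_{i+k}=x_i+1$, $x_{i+k+\frac12}=x_{i+\frac12}+1$, each $x_i$ is a local minimum and each $x_{i+\frac12}$ a local maximum of $U$. Let $\mathbb S^1=\mathbb R/\mathbb Z$, let $H(p,x)=p(p-U'(x))$ and let $L(s,x)=\sup_p(sp-H(p,x))=\frac14(s+U'(x))^2$ be the associated Lagrangian. For $x,y\in\mathbb S^1$ and $T\ge0$ put $$A_T(y;x)=\inf_{\gamma(0)=x,\ \gamma(T)=y}\int_0^T L(\dot\gamma,\gamma)\,dt\in[0,\infty]$$ (infimum over absolutely continuous curves $\gamma:[0,T]\to\mathbb S^1$), and define the Mañé potential $v(y;x)=\inf_{T\ge 0}A_T(y;x)$, the Peierls barrier $h(y;x)=\liminf_{T\to+\infty}A_T(y;x)$, the projected Aubry set $\mathcal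 A=\{x\in\mathbb S^1: h(x;x)=0\}$, and the Lax--Oleinik semigroup $(S_tu)(y)=\inf_{x\in\mathbb S^1}\{u(x)+A_t(y;x)\}$, $t\ge0$. A weak KAM solution (of negative type) of $H(w'(x),x)=0$ on $\mathbb S^1$ is a function $w\in C(\mathbb S^1)$ such that (I) $w(\gamma(b))-w(\gamma(a))\le\int_a^bL(\dot\gamma,\gamma)\,dt$ for every absolutely continuous curve $\gamma:[a,b]\to\mathbb S^1$, and (II) for every $x\in\mathbb S^1$ there is a continuous, piecewise $C^1$ curve $\gamma:(-\infty,0]\to\mathbb S^1$ with $\gamma(0)=x$ and $w(\gamma(b))-w(\gamma(a))=\int_a^bL(\dot\gamma,\gamma)\,dt$ for all $a<b\le0$. Then $\mathcal A$ is the set of (the classes in $\mathbb S^1$ of) the critical points $x_i, x_{i+\frac12}$ of $U$, and every weak KAM solution $w$ satisfies $S_tw=w$ for all $t\ge0$ and $$w(y)=\inf_{x\in\mathbb S^1}\{w(x)+v(y;x)\}=\inf_{x\in\mathcal A}\{w(x)+h(y;x)\}\qquad\text{for all }y\in\mathbb S^1 .$$ In particular, let $W$ be the Freidlin--Wentzell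 function, defined as follows. For $p,q\in\mathbb R$ let $B(q;p)$ be the infimum of $\int_0^TL(\dot\gamma,\gamma)\,dt$ over all $T\ge0$ and all absolutely continuous curves $\gamma:[0,T]\to\mathbb R$ with $\gamma(0)=p$, $\gamma(T)=q$. For $1\le i,j\le k$ let $\tilde h_R(x_i;x_{j+1})$ be $B(x_i;x_{j+1})$ if $j<i$ and $B(x_{i+k};x_{j+1})$ if $j\ge i$, and let $\tilde h_L(x_i;x_j)$ be $B(x_i;x_j)$ if $j\ge i$ and $B(x_{i-k};x_j)$ if $j<i$. Put $$W_i=\min_{1\le j\le k}\bigl(\tilde h_R(x_i;x_{j+1})+\tilde h_L(x_i;x_j)\bigr),\qquad W(y)=\min_{1\le j\le k}\bigl(W_j+h(y;x_j)\bigr),\quad y\in\mathbb S^1 .$$ Then $W$ is finite on $\mathbb S^1$ and $S_tW=W$ for all $t\ge0$. -/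

import Mathlib

open Set Filter MeasureTheory
open scoped ENNReal ContDiff

noncomputable section

/-- A smooth skew periodic potential: `U = V - b x` with `V` smooth and `1`-periodic. -/
def IsSkewPeriodicPotential (U : ℝ → ℝ) : Prop :=
  ContDiff ℝ ∞ U ∧ ∃ (V : ℝ → ℝ) (b : ℝ),
    ContDiff ℝ ∞ V ∧ Function.Periodic V 1 ∧ ∀ p, U p = V p - b * p

/-- The critical points of `U` are listed as follows: there are `k ≥ 1` local minima
`x 1, …, x k` in each period, interleaved by `k` local maxima `z 1, …, z k`
(`z i` stands for `x_{i+1/2}`), both families being extended to all integer indices by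
`x (i + k) = x i + 1` and `z (i + k) = z i + 1`; there are no other critical points. -/
structure HasInterleavedCriticalPoints (U : ℝ → ℝ) (k : ℕ) (x z : ℤ → ℝ) : Prop where
  pos : 0 < k
  x_add : ∀ i, x (i + k) = x i + 1
  z_add : ∀ i, z (i + k) = z i + 1
  x_lt_z : ∀ i, x i < z i
  z_lt_x : ∀ i, z i < x (i + 1)
  isLocalMin : ∀ i, IsLocalMin U (x i)
  isLocalMax : ∀ i, IsLocalMax U (z i)
  critical_iff : ∀ p, deriv U p = 0 ↔ (∃ i, p = x i) ∨ (∃ i, p = z i)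

/-- The Hamiltonian `H(p, q) = p (p - U'(q))`. -/
def hamiltonian (U : ℝ → ℝ) (p q : ℝ) : ℝ := p * (p - deriv U q)

/-- The Lagrangian `L(s, q) = (s + U'(q))² / 4`. For a skew periodic `U` it is `1`-periodic
in `q`, so it is a Lagrangian on the circle `ℝ / ℤ`. -/
def lagrangian (U : ℝ → ℝ) (s q : ℝ) : ℝ := (s + deriv U q) ^ 2 / 4

/-- `L` is the convex conjugate of `H`. -/
theorem isLUB_lagrangian (U : ℝ → ℝ) (s q : ℝ) :
    IsLUB (range fun p => s * p - hamiltonian U p q) (lagrangian U s q) := by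
  constructor
  · rintro _ ⟨p, rfl⟩
    simp only [hamiltonian, lagrangian]
    nlinarith [sq_nonneg (s + deriv U q - 2 * p)]
  · intro c hc
    have h := hc ⟨(s + deriv U q) / 2, rfl⟩
    simp only [hamiltonian] at h
    simp only [lagrangian]
    linarith

/-- The action `∫_a^b L(γ'(t), γ(t)) dt ∈ [0, ∞]` of a curve `γ`. Curves on the circle are
given by their lifts to `ℝ`: the absolutely continuous (resp. piecewise `C¹`) curves on the
circle are exactly the projections `t ↦ (γ t : UnitAddCircle)` of absolutely continuous
(resp. piecewise `C¹`) curves `γ` on `ℝ`, and have the same velocity and the same action. -/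
def action (U : ℝ → ℝ) (γ : ℝ → ℝ) (a b : ℝ) : ℝ≥0∞ :=
  ∫⁻ t in Icc a b, ENNReal.ofReal (lagrangian U (deriv γ t) (γ t))

/-- The least action, in time exactly `T`, of curves on the circle from `x` to `y`. -/
def leastAction (U : ℝ → ℝ) (T : ℝ) (y x : UnitAddCircle) : ℝ≥0∞ :=
  ⨅ (γ : ℝ → ℝ) (_ : AbsolutelyContinuousOnInterval γ 0 T)
    (_ : (γ 0 : UnitAddCircle) = x) (_ : (γ T : UnitAddCircle) = y), action U γ 0 T

/-- The Mañé potential `v(y; x)` on the circle (the critical value is `0`). -/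
def manePotential (U : ℝ → ℝ) (y x : UnitAddCircle) : ℝ≥0∞ :=
  ⨅ (T : ℝ) (_ : 0 ≤ T), leastAction U T y x

/-- The Peierls barrier `h(y; x)` on the circle. -/
def peierlsBarrier (U : ℝ → ℝ) (y x : UnitAddCircle) : ℝ≥0∞ :=
  liminf (fun T : ℝ => leastAction U T y x) atTop

/-- The projected Aubry set `{x | h(x; x) = 0}`. -/
def projectedAubrySet (U : ℝ → ℝ) : Set UnitAddCircle :=
  {x | peierlsBarrier U x x = 0}

/-- The Lax–Oleinik semigroup,
`(S_t u)(y) = inf_x (u(x) + inf_{γ(0) = x, γ(t) = y} ∫_0^t L(γ', γ))`. -/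
def laxOleinik (U : ℝ → ℝ) (t : ℝ) (u : UnitAddCircle → EReal) (y : UnitAddCircle) : EReal :=
  ⨅ x : UnitAddCircle, u x + (leastAction U t y x : EReal)

/-- `γ` is continuous and piecewise `C¹` on `(-∞, 0]`: every `[a, 0]` splits into finitely many
closed intervals on each of which `γ` is `C¹` up to the end points. -/
def IsPiecewiseC1OnIic (γ : ℝ → ℝ) : Prop :=
  ContinuousOn γ (Iic 0) ∧ ∀ a < 0, ∃ (n : ℕ) (τ : ℕ → ℝ), τ 0 = a ∧ τ n = 0 ∧
    ∀ i < n, τ i < τ (i + 1) ∧ ContDiffOn ℝ 1 γ (Icc (τ i) (τ (i + 1)))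

/-- Weak KAM solutions (of negative type) of `H(w'(x), x) = 0` on the circle. -/
structure IsWeakKAMSolution (U : ℝ → ℝ) (w : UnitAddCircle → ℝ) : Prop where
  continuous : Continuous w
  dominated : ∀ (γ : ℝ → ℝ) (a b : ℝ), a ≤ b → AbsolutelyContinuousOnInterval γ a b →
    ((w (γ b) - w (γ a) : ℝ) : EReal) ≤ (action U γ a b : EReal)
  calibrated : ∀ x : UnitAddCircle, ∃ γ : ℝ → ℝ, (γ 0 : UnitAddCircle) = x ∧
    IsPiecewiseC1OnIic γ ∧ ∀ a b : ℝ, a < b → b ≤ 0 →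
      ((w (γ b) - w (γ a) : ℝ) : EReal) = (action U γ a b : EReal)

/-- The least action of curves on the real line (the universal cover of the circle) from `p`
to `q`, over all times. For `q ≥ p` this is the right barrier `h_R(q; p)`, for `q ≤ p` it is
the left barrier `h_L(q; p)`. -/
def lineBarrier (U : ℝ → ℝ) (q p : ℝ) : ℝ≥0∞ :=
  ⨅ (T : ℝ) (_ : 0 ≤ T) (γ : ℝ → ℝ) (_ : AbsolutelyContinuousOnInterval γ 0 T)
    (_ : γ 0 = p) (_ : γ T = q), action U γ 0 T

/-- The cost `h̃_R(x_i; x_{j+1})` of the counterclockwise path from `x_{j+1}` to `x_i`,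
`1 ≤ i, j ≤ k`. -/
def costRight (U : ℝ → ℝ) (k : ℕ) (x : ℤ → ℝ) (i j : ℤ) : ℝ≥0∞ :=
  if j < i then lineBarrier U (x i) (x (j + 1)) else lineBarrier U (x (i + k)) (x (j + 1))

/-- The cost `h̃_L(x_i; x_j)` of the clockwise path from `x_j` to `x_i`, `1 ≤ i, j ≤ k`. -/
def costLeft (U : ℝ → ℝ) (k : ℕ) (x : ℤ → ℝ) (i j : ℤ) : ℝ≥0∞ :=
  if i ≤ j then lineBarrier U (x i) (x j) else lineBarrier U (x (i - k)) (x j)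

/-- The Freidlin–Wentzell boundary values
`W_i = min_{1 ≤ j ≤ k} (h̃_R(x_i; x_{j+1}) + h̃_L(x_i; x_j))`. -/
def boundaryValue (U : ℝ → ℝ) (k : ℕ) (x : ℤ → ℝ) (i : ℤ) : ℝ≥0∞ :=
  ⨅ j ∈ Icc (1 : ℤ) k, (costRight U k x i j + costLeft U k x i j)

/-- The Freidlin–Wentzell function `W(y) = min_{1 ≤ j ≤ k} (W_j + h(y; x_j))`. -/
def freidlinWentzell (U : ℝ → ℝ) (k : ℕ) (x : ℤ → ℝ) (y : UnitAddCircle) : ℝ≥0∞ :=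
  ⨅ j ∈ Icc (1 : ℤ) k, (boundaryValue U k x j + peierlsBarrier U y (x j : UnitAddCircle))

end

/-! Since `L ≥ 0`, the constant curve at a critical point of `U` costs nothing, so critical points
lie in the Aubry set. For the converse, `U'` takes both signs, because `U` has a local minimum with
no other critical point nearby. Weighting the positive and negative parts of `U'` by factors in `(0,
1)` gives a `ψ` of mean zero lying strictly between `0` and `U'` wherever `U' ≠ 0`. Its primitive
`φ` is periodic, and completing the square gives `L(s, q) ≥ ψ(q) s + ψ(q) (U'(q) - ψ(q))`. Along a
loop the first term integrates to zero. A loop based at a noncritical point either lingers there and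
collects a definite amount of the second term, or leaves quickly, which is also costly. Hence `h >
0` there (`peierlsBarrier_self_pos`). Both signs are essential: if `U'` had no zero, the flow of
`-U'` would give free loops through every point.

For a weak KAM solution, domination gives one inequality in each formula and a backward calibrated
curve gives the other. For the Aubry representation, any limit point of that curve at time `-∞` is a
point of the Aubry set realizing the infimum (`exists_mem_projectedAubrySet`).

The invariance of `W` rests on `h(·; c)` being a fixed point of the semigroup when `c` is critical:
the triangle inequality gives one direction, and cutting long curves at time `t` before their end
gives the other, since waiting at `c` is free. Taking minima and adding constants preserves this. -/

/-! ### Operations on absolutely continuous curves. -/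

theorem AbsolutelyContinuousOnInterval.congr_of_eqOn {f g : ℝ → ℝ} {a b : ℝ}
    (hf : AbsolutelyContinuousOnInterval f a b) (h : EqOn f g (uIcc a b)) :
    AbsolutelyContinuousOnInterval g a b := by
  rw [absolutelyContinuousOnInterval_iff] at hf ⊢
  intro ε hε
  obtain ⟨δ, hδ, H⟩ := hf ε hε
  refine ⟨δ, hδ, fun E hE hlen => lt_of_eq_of_lt (Finset.sum_congr rfl fun i hi => ?_) (H E hE hlen)⟩
  rw [h (hE.1 i hi).1, h (hE.1 i hi).2]

/-- Precomposition with a monotone `1`-Lipschitz function preserves absolute continuity. -/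
theorem AbsolutelyContinuousOnInterval.comp_monotone {f g : ℝ → ℝ} {a b c d : ℝ}
    (hf : AbsolutelyContinuousOnInterval f c d) (hg : Monotone g)
    (hlip : ∀ s t, dist (g s) (g t) ≤ dist s t) (hmaps : ∀ t ∈ uIcc a b, g t ∈ uIcc c d) :
    AbsolutelyContinuousOnInterval (fun t => f (g t)) a b := by
  rw [absolutelyContinuousOnInterval_iff] at hf ⊢
  intro ε hε
  obtain ⟨δ, hδ, H⟩ := hf ε hε
  refine ⟨δ, hδ, fun E hE hlen => H (E.1, fun i => (g (E.2 i).1, g (E.2 i).2)) ⟨?_, ?_⟩ ?_⟩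
  · exact fun i hi => ⟨hmaps _ (hE.1 i hi).1, hmaps _ (hE.1 i hi).2⟩
  · intro i hi j hj hij
    have hd := hE.2 hi hj hij
    simp only [Function.onFun, uIoc, Set.Ioc_disjoint_Ioc, ← hg.map_max, ← hg.map_min] at hd ⊢
    exact hg hd
  · exact (Finset.sum_le_sum fun i _ => hlip _ _).trans_lt hlen

theorem AbsolutelyContinuousOnInterval.comp_add_const {f : ℝ → ℝ} {a b : ℝ} (c : ℝ)
    (hf : AbsolutelyContinuousOnInterval f (a + c) (b + c)) :
    AbsolutelyContinuousOnInterval (fun t => f (t + c)) a b := by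
  refine hf.comp_monotone (fun s t h => by linarith) (fun s t => by simp) fun t ht => ?_
  rw [mem_uIcc] at ht ⊢
  rcases ht with h | h
  · left; constructor <;> linarith [h.1, h.2]
  · right; constructor <;> linarith [h.1, h.2]

theorem AbsolutelyContinuousOnInterval.add_const {f : ℝ → ℝ} {a b : ℝ}
    (hf : AbsolutelyContinuousOnInterval f a b) (c : ℝ) :
    AbsolutelyContinuousOnInterval (fun t => f t + c) a b := by
  rw [absolutelyContinuousOnInterval_iff] at hf ⊢
  simpa using hf

/-- Gluing follows from `f t = f (min t b) + f (max t b) - f b`, where both truncations of time are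
monotone and `1`-Lipschitz. -/
theorem AbsolutelyContinuousOnInterval.trans {f : ℝ → ℝ} {a b c : ℝ} (hab : a ≤ b) (hbc : b ≤ c)
    (h₁ : AbsolutelyContinuousOnInterval f a b) (h₂ : AbsolutelyContinuousOnInterval f b c) :
    AbsolutelyContinuousOnInterval f a c := by
  have hmin : AbsolutelyContinuousOnInterval (fun t => f (min t b)) a c := by
    refine h₁.comp_monotone (fun s t h => min_le_min_right b h)
      (fun s t => by simpa [Real.dist_eq] using abs_min_sub_min_le_max s b t b) fun t ht => ?_
    rw [uIcc_of_le (hab.trans hbc)] at ht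
    rw [uIcc_of_le hab]
    exact ⟨le_min ht.1 hab, min_le_right _ _⟩
  have hmax : AbsolutelyContinuousOnInterval (fun t => f (max t b)) a c := by
    refine h₂.comp_monotone (fun s t h => max_le_max_right b h)
      (fun s t => by simpa [Real.dist_eq] using abs_max_sub_max_le_max s b t b) fun t ht => ?_
    rw [uIcc_of_le (hab.trans hbc)] at ht
    rw [uIcc_of_le hbc]
    exact ⟨le_max_right _ _, max_le ht.2 hbc⟩
  refine ((hmin.fun_add hmax).add_const (-f b)).congr_of_eqOn fun t _ => ?_
  rcases le_total t b with h | h <;> simp [h]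

theorem LipschitzWith.comp_absolutelyContinuousOnInterval {φ f : ℝ → ℝ} {K : NNReal} {a b : ℝ}
    (hφ : LipschitzWith K φ) (hf : AbsolutelyContinuousOnInterval f a b) :
    AbsolutelyContinuousOnInterval (fun t => φ (f t)) a b := by
  rw [absolutelyContinuousOnInterval_iff] at hf ⊢
  intro ε hε
  -- `K + 1` rather than `K` covers the case `K = 0`.
  obtain ⟨δ, hδ, H⟩ := hf (ε / (K + 1)) (by positivity)
  refine ⟨δ, hδ, fun E hE hlen => ?_⟩
  calc ∑ i ∈ Finset.range E.1, dist (φ (f (E.2 i).1)) (φ (f (E.2 i).2))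
      ≤ ∑ i ∈ Finset.range E.1, (K + 1) * dist (f (E.2 i).1) (f (E.2 i).2) := by
        refine Finset.sum_le_sum fun i _ => (hφ.dist_le_mul _ _).trans ?_
        gcongr
        linarith
    _ < ε := by
        rw [← Finset.mul_sum]
        have := H E hE hlen
        rwa [lt_div_iff₀' (by positivity)] at this

/-! ### The action functional and the least action in fixed time. -/

section Action

variable {U : ℝ → ℝ}

theorem IsSkewPeriodicPotential.periodic_deriv (hU : IsSkewPeriodicPotential U) :
    Function.Periodic (deriv U) 1 := by
  obtain ⟨-, V, b, -, hper, hUV⟩ := hU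
  intro p
  have h : (fun q => U (q + 1)) = fun q => U q - b := by
    funext q
    rw [hUV, hUV, hper q]
    ring
  rw [← deriv_comp_add_const, h, deriv_sub_const]

theorem IsSkewPeriodicPotential.continuous_deriv (hU : IsSkewPeriodicPotential U) :
    Continuous (deriv U) :=
  hU.1.continuous_deriv (by simp)

theorem IsSkewPeriodicPotential.exists_bound (hU : IsSkewPeriodicPotential U) :
    ∃ M, 0 ≤ M ∧ ∀ p, |deriv U p| ≤ M := by
  obtain ⟨M, hM⟩ := isCompact_Icc.exists_bound_of_continuousOn (s := Icc (0 : ℝ) 1)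
    hU.continuous_deriv.continuousOn
  refine ⟨M, (norm_nonneg _).trans (hM 0 (by simp)), fun p => ?_⟩
  obtain ⟨q, hq, h⟩ := hU.periodic_deriv.exists_mem_Ico₀ one_pos p
  rw [h]
  exact hM q ⟨hq.1, hq.2.le⟩

/-- On an open interval, agreement of two curves forces agreement of their derivatives. -/
theorem action_eq_Ioo (γ : ℝ → ℝ) (a b : ℝ) :
    action U γ a b = ∫⁻ t in Ioo a b, ENNReal.ofReal (lagrangian U (deriv γ t) (γ t)) := by
  rw [action, restrict_Ioo_eq_restrict_Icc]

theorem action_eq_Ioc (γ : ℝ → ℝ) (a b : ℝ) :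
    action U γ a b = ∫⁻ t in Ioc a b, ENNReal.ofReal (lagrangian U (deriv γ t) (γ t)) := by
  rw [action, restrict_Ioc_eq_restrict_Icc]

theorem action_add (γ : ℝ → ℝ) {a b c : ℝ} (hab : a ≤ b) (hbc : b ≤ c) :
    action U γ a c = action U γ a b + action U γ b c := by
  simp only [action_eq_Ioc]
  rw [← Ioc_union_Ioc_eq_Ioc hab hbc, lintegral_union measurableSet_Ioc
    (Ioc_disjoint_Ioc_of_le le_rfl)]

theorem action_mono (γ : ℝ → ℝ) {a b c : ℝ} (hbc : b ≤ c) :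
    action U γ a b ≤ action U γ a c :=
  lintegral_mono_set (Icc_subset_Icc_right hbc)

/-- The action is invariant under translations in time and integer translations in space. -/
theorem action_translate (hper : Function.Periodic (deriv U) 1) {γ₁ γ₂ : ℝ → ℝ} {a b c : ℝ}
    {n : ℤ} (h : ∀ t ∈ Ioo a b, γ₁ t = γ₂ (t + c) + n) :
    action U γ₁ a b = action U γ₂ (a + c) (b + c) := by
  have hpre : (fun t => t + c) ⁻¹' Ioo (a + c) (b + c) = Ioo a b := by simp
  rw [action_eq_Ioo, action_eq_Ioo, ← (measurePreserving_add_right volume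
    c).setLIntegral_comp_preimage_emb (measurableEmbedding_addRight c) _ (Ioo (a + c) (b + c)), hpre]
  refine setLIntegral_congr_fun measurableSet_Ioo fun t ht => ?_
  have hd : deriv γ₁ t = deriv γ₂ (t + c) := by
    have : γ₁ =ᶠ[nhds t] fun t => γ₂ (t + c) + n := by
      filter_upwards [Ioo_mem_nhds ht.1 ht.2] with s hs using h s hs
    rw [this.deriv_eq, deriv_add_const, deriv_comp_add_const]
  have hp : deriv U (γ₂ (t + c) + n) = deriv U (γ₂ (t + c)) := by
    simpa using hper.int_mul n (γ₂ (t + c))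
  simp only [lagrangian, hd, h t ht, hp]

theorem leastAction_le (γ : ℝ → ℝ) {T : ℝ} (hγ : AbsolutelyContinuousOnInterval γ 0 T) :
    leastAction U T (γ T) (γ 0) ≤ action U γ 0 T :=
  iInf₂_le_of_le γ hγ (iInf₂_le_of_le rfl rfl le_rfl)

theorem le_leastAction {T : ℝ} {y x : UnitAddCircle} {r : ℝ≥0∞}
    (h : ∀ γ : ℝ → ℝ, AbsolutelyContinuousOnInterval γ 0 T → (γ 0 : UnitAddCircle) = x →
      (γ T : UnitAddCircle) = y → r ≤ action U γ 0 T) : r ≤ leastAction U T y x :=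
  le_iInf₂ fun γ hγ => le_iInf₂ (h γ hγ)

theorem leastAction_le_action (hper : Function.Periodic (deriv U) 1) (γ : ℝ → ℝ) {a b : ℝ}
    (hγ : AbsolutelyContinuousOnInterval γ a b) :
    leastAction U (b - a) (γ b) (γ a) ≤ action U γ a b := by
  have h := leastAction_le (U := U) (fun t => γ (t + a)) (T := b - a)
    (AbsolutelyContinuousOnInterval.comp_add_const a (by simpa using hγ))
  rw [action_translate hper (γ₂ := γ) (c := a) (n := 0) (by simp)] at h
  simpa using h

theorem exists_int_of_coe_eq {p q : ℝ} (h : (p : UnitAddCircle) = q) : ∃ n : ℤ, p = q + n := by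
  rw [← sub_eq_zero, ← AddCircle.coe_sub, AddCircle.coe_eq_zero_iff] at h
  obtain ⟨n, hn⟩ := h
  exact ⟨n, by rw [zsmul_one] at hn; linarith⟩

theorem leastAction_triangle (hper : Function.Periodic (deriv U) 1) {S T : ℝ} (hS : 0 ≤ S)
    (hT : 0 ≤ T) (x q y : UnitAddCircle) :
    leastAction U (S + T) y x ≤ leastAction U S q x + leastAction U T y q := by
  rw [leastAction.eq_def U S, leastAction.eq_def U T]
  simp only [ENNReal.iInf_add, ENNReal.add_iInf]
  refine le_iInf₂ fun γ₂ h₂ => le_iInf₂ fun hq' hy => le_iInf₂ fun γ₁ h₁ => le_iInf₂ fun hx hq => ?_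
  -- The two lifts meet only modulo `ℤ`; the second is shifted by `n` to make the concatenation
  -- continuous.
  obtain ⟨n, hn⟩ := exists_int_of_coe_eq (hq.trans hq'.symm)
  set γ : ℝ → ℝ := fun t => if t ≤ S then γ₁ t else γ₂ (t + -S) + n with hγ
  have hγ₁ : ∀ t ≤ S, γ t = γ₁ t := fun t ht => if_pos ht
  have hγ₂ : ∀ t, S ≤ t → γ t = γ₂ (t + -S) + n := by
    intro t ht
    rcases ht.eq_or_lt with rfl | ht
    · rw [hγ₁ _ le_rfl, hn, add_neg_cancel]
    · exact if_neg ht.not_ge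
  have hac₁ : AbsolutelyContinuousOnInterval γ 0 S := by
    refine h₁.congr_of_eqOn fun t ht => (hγ₁ t ?_).symm
    rw [uIcc_of_le hS] at ht
    exact ht.2
  have hac₂ : AbsolutelyContinuousOnInterval γ S (S + T) := by
    refine ((AbsolutelyContinuousOnInterval.comp_add_const (f := γ₂) (-S)
      (by simpa using h₂)).add_const n).congr_of_eqOn fun t ht => (hγ₂ t ?_).symm
    rw [uIcc_of_le (by linarith)] at ht
    exact ht.1
  have h := leastAction_le (U := U) γ (hac₁.trans hS (by linarith) hac₂)
  rw [action_add γ hS (by linarith : S ≤ S + T),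
    action_translate hper (γ₁ := γ) (γ₂ := γ₁) (c := 0) (n := 0)
      (fun t ht => by simpa using hγ₁ t ht.2.le),
    action_translate hper (γ₁ := γ) (γ₂ := γ₂) (c := -S) (n := n) (fun t ht => hγ₂ t ht.1.le),
    hγ₁ 0 hS, hγ₂ (S + T) (by linarith)] at h
  have hn0 : ((n : ℝ) : UnitAddCircle) = 0 := by
    rw [AddCircle.coe_eq_zero_iff]
    exact ⟨n, by simp⟩
  simpa [hx, hy, hn0] using h

theorem action_line_le {M : ℝ} (hM : ∀ p, |deriv U p| ≤ M) (p v : ℝ) {T : ℝ} :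
    action U (fun t => p + v * t) 0 T ≤
      ENNReal.ofReal ((|v| + M) ^ 2 / 4) * ENNReal.ofReal T := by
  have hd : ∀ t, deriv (fun t => p + v * t) t = v := fun t => by
    simp
  calc action U (fun t => p + v * t) 0 T
      ≤ ∫⁻ _ in Icc 0 T, ENNReal.ofReal ((|v| + M) ^ 2 / 4) := by
        refine lintegral_mono fun t => ENNReal.ofReal_le_ofReal ?_
        rw [hd, lagrangian]
        have h : |v + deriv U (p + v * t)| ≤ |v| + M :=
          (abs_add_le _ _).trans (by linarith [hM (p + v * t)])
        have := sq_le_sq' (by linarith [abs_le.1 h]) (abs_le.1 h).2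
        linarith
    _ = _ := by simp

theorem absolutelyContinuousOnInterval_line (p v a b : ℝ) :
    AbsolutelyContinuousOnInterval (fun t => p + v * t) a b :=
  ContDiffOn.absolutelyContinuousOnInterval (by fun_prop)

theorem leastAction_norm_sub_le {M : ℝ} (hM : ∀ p, |deriv U p| ≤ M) (x y : UnitAddCircle) :
    leastAction U ‖y - x‖ y x ≤ ENNReal.ofReal ((1 + M) ^ 2 / 4) * ENNReal.ofReal ‖y - x‖ := by
  obtain ⟨p, rfl⟩ := QuotientAddGroup.mk_surjective x
  obtain ⟨q, rfl⟩ := QuotientAddGroup.mk_surjective y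
  have hM0 : 0 ≤ M := (abs_nonneg _).trans (hM 0)
  -- `e` is the signed length of a shortest arc, which is run through at unit speed; if `e = 0` the
  -- curve is constant.
  set e := (q - p) - round (q - p) with he
  have hnorm : ‖(q : UnitAddCircle) - (p : UnitAddCircle)‖ = |e| := by
    rw [← AddCircle.coe_sub, UnitAddCircle.norm_eq]
  have hround : ((round (q - p) : ℝ) : UnitAddCircle) = 0 := by
    rw [AddCircle.coe_eq_zero_iff]
    exact ⟨round (q - p), by simp⟩
  have hend : p + SignType.sign e * |e| = q - round (q - p) := by
    rw [sign_mul_abs, he]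
    ring
  have h := leastAction_le (U := U) _ (absolutelyContinuousOnInterval_line p (SignType.sign e) 0 |e|)
  rw [hend, AddCircle.coe_sub, hround] at h
  change leastAction U ‖(q : UnitAddCircle) - (p : UnitAddCircle)‖ q p ≤ _ * ENNReal.ofReal ‖(q : UnitAddCircle) - (p : UnitAddCircle)‖
  rw [hnorm]
  simp only [mul_zero, add_zero, sub_zero] at h
  refine (h.trans (action_line_le hM _ _)).trans ?_
  have hs : |(SignType.sign e : ℝ)| ≤ 1 := by
    cases SignType.sign e <;> simp
  gcongr

theorem leastAction_one_ne_top {M : ℝ} (hM : ∀ p, |deriv U p| ≤ M) (x y : UnitAddCircle) :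
    leastAction U 1 y x ≠ ⊤ := by
  obtain ⟨p, rfl⟩ := QuotientAddGroup.mk_surjective x
  obtain ⟨q, rfl⟩ := QuotientAddGroup.mk_surjective y
  have h := (leastAction_le (U := U) _ (absolutelyContinuousOnInterval_line p (q - p) 0 1)).trans
    (action_line_le hM p (q - p))
  simp only [mul_zero, add_zero, mul_one, add_sub_cancel] at h
  exact ne_top_of_le_ne_top (by finiteness) h

theorem lineBarrier_ne_top {M : ℝ} (hM : ∀ p, |deriv U p| ≤ M) (p q : ℝ) :
    lineBarrier U q p ≠ ⊤ := by
  have h : lineBarrier U q p ≤ action U (fun t => p + (q - p) * t) 0 1 :=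
    iInf₂_le_of_le 1 zero_le_one (iInf₂_le_of_le _ (absolutelyContinuousOnInterval_line _ _ _ _)
      (iInf₂_le_of_le (by simp) (by simp) le_rfl))
  exact ne_top_of_le_ne_top (by finiteness) (h.trans (action_line_le hM p (q - p)))

/-- Integrable lower bounds of the Lagrangian along a curve integrate to lower bounds of its
action. -/
theorem ofReal_integral_le_action {γ f : ℝ → ℝ} {a b : ℝ} (hab : a ≤ b)
    (hf : IntervalIntegrable f volume a b) (hle : ∀ t, f t ≤ lagrangian U (deriv γ t) (γ t)) :
    ENNReal.ofReal (∫ t in a..b, f t) ≤ action U γ a b := by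
  rw [intervalIntegral.integral_of_le hab, action_eq_Ioc]
  have hi : Integrable f (volume.restrict (Ioc a b)) := hf.1
  calc ENNReal.ofReal (∫ t in Ioc a b, f t)
      ≤ ENNReal.ofReal (∫ t in Ioc a b, max (f t) 0) :=
        ENNReal.ofReal_le_ofReal (integral_mono hi hi.pos_part fun t => le_max_left _ _)
    _ = ∫⁻ t in Ioc a b, ENNReal.ofReal (max (f t) 0) :=
        ofReal_integral_eq_lintegral_ofReal hi.pos_part (ae_of_all _ fun t => le_max_right _ _)
    _ ≤ _ := lintegral_mono fun t => ENNReal.ofReal_le_ofReal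
        (max_le (hle t) (by rw [lagrangian]; positivity))

/-- In bounded time a curve of small action moves only a little. -/
theorem ofReal_abs_sub_le_action {M : ℝ} (hM : ∀ p, |deriv U p| ≤ M) {γ : ℝ → ℝ} {T : ℝ}
    (hT : 0 ≤ T) (hγ : AbsolutelyContinuousOnInterval γ 0 T) :
    ENNReal.ofReal (|γ T - γ 0| - (1 + M) * T) ≤ action U γ 0 T := by
  have key : ∀ σ : ℝ, |σ| = 1 →
      ENNReal.ofReal (σ * (γ T - γ 0) - (1 + M) * T) ≤ action U γ 0 T := by
    intro σ hσ
    have hi := hγ.intervalIntegrable_deriv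
    have h := ofReal_integral_le_action (U := U) (γ := γ) (f := fun t => σ * deriv γ t - (1 + M)) hT
      ((hi.const_mul σ).sub intervalIntegrable_const) fun t => by
        have h1 : σ * deriv γ t ≤ |deriv γ t| := by
          simpa [abs_mul, hσ] using le_abs_self (σ * deriv γ t)
        have h2 : |deriv γ t| ≤ |deriv γ t + deriv U (γ t)| + M := by
          have := abs_sub (deriv γ t + deriv U (γ t)) (deriv U (γ t))
          rw [add_sub_cancel_right] at this
          linarith [hM (γ t)]
        -- With `a = |γ' + U'(γ)|`, the inequality `a - 1 ≤ a² / 4` is `(a - 2)² ≥ 0`; this is the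
        -- source of the `1` in `1 + M`.
        rw [lagrangian, ← sq_abs]
        nlinarith [sq_nonneg (|deriv γ t + deriv U (γ t)| - 2)]
    rw [intervalIntegral.integral_sub (hi.const_mul σ) intervalIntegrable_const,
      intervalIntegral.integral_const_mul, hγ.integral_deriv_eq_sub] at h
    rwa [intervalIntegral.integral_const, smul_eq_mul, sub_zero, mul_comm T] at h
  rcases abs_choice (γ T - γ 0) with h | h
  · rw [h]; simpa using key 1 (by simp)
  · rw [h]; simpa using key (-1) (by simp)

end Action

/-! ### The Peierls barrier and weak KAM solutions. -/

section Barrier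

variable {U : ℝ → ℝ}

theorem peierlsBarrier_le_of_frequently {y x : UnitAddCircle} {r : ℝ≥0∞}
    (h : ∃ᶠ T in atTop, leastAction U T y x ≤ r) : peierlsBarrier U y x ≤ r :=
  liminf_le_of_frequently_le' h

theorem le_peierlsBarrier_of_eventually {y x : UnitAddCircle} {r : ℝ≥0∞}
    (h : ∀ᶠ T in atTop, r ≤ leastAction U T y x) : r ≤ peierlsBarrier U y x :=
  le_liminf_of_le (by isBoundedDefault) h

theorem liminf_le_liminf_comp_add_const (f : ℝ → ℝ≥0∞) (t : ℝ) :
    liminf f atTop ≤ liminf (fun T => f (T + t)) atTop := by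
  have h := liminf_le_liminf_of_le (u := f) (tendsto_atTop_add_const_right atTop t tendsto_id)
  rwa [← liminf_comp] at h

theorem peierlsBarrier_triangle (hper : Function.Periodic (deriv U) 1) {t : ℝ} (ht : 0 ≤ t)
    (x q y : UnitAddCircle) :
    peierlsBarrier U y x ≤ peierlsBarrier U q x + leastAction U t y q := by
  have hcob : IsBoundedUnder (· ≥ ·) atTop fun T => leastAction U T q x := by isBoundedDefault
  rw [peierlsBarrier, peierlsBarrier, ← liminf_add_const _ _ _ (by isBoundedDefault) hcob]
  refine (liminf_le_liminf_comp_add_const _ t).trans (liminf_le_liminf ?_)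
  filter_upwards [eventually_ge_atTop 0] with T hT
  exact leastAction_triangle hper hT ht x q y

theorem leastAction_self_eq_zero_of_deriv_eq_zero {c : ℝ} (hc : deriv U c = 0) (T : ℝ) :
    leastAction U T (c : UnitAddCircle) c = 0 := by
  have h := leastAction_le (U := U) (fun _ => c) (T := T)
    (ContDiffOn.absolutelyContinuousOnInterval (by fun_prop))
  simpa [action, lagrangian, hc] using h

/-- Waiting at a critical point is free. -/
theorem peierlsBarrier_le_leastAction (hper : Function.Periodic (deriv U) 1) {c : ℝ}
    (hc : deriv U c = 0) {T : ℝ} (hT : 0 ≤ T) (y : UnitAddCircle) :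
    peierlsBarrier U y c ≤ leastAction U T y c := by
  refine peierlsBarrier_le_of_frequently (Eventually.frequently ?_)
  filter_upwards [eventually_ge_atTop T] with S hS
  have h := leastAction_triangle hper (sub_nonneg.2 hS) hT c c y
  rwa [leastAction_self_eq_zero_of_deriv_eq_zero hc, zero_add, sub_add_cancel] at h

/-- Truncating at zero loses nothing because `a ≥ 0`. Domination inequalities can thus be handled in
`ℝ≥0∞`. -/
theorem EReal.coe_sub_le_coe_ennreal_iff {r s : ℝ} {a : ℝ≥0∞} :
    ((r - s : ℝ) : EReal) ≤ a ↔ ENNReal.ofReal (r - s) ≤ a := by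
  rw [← EReal.coe_ennreal_le_coe_ennreal_iff, EReal.coe_ennreal_ofReal, EReal.coe_strictMono.monotone.map_max,
    max_le_iff]
  exact ⟨fun h => ⟨h, EReal.coe_ennreal_nonneg a⟩, And.left⟩

theorem EReal.coe_le_coe_add_coe_ennreal_iff {r s : ℝ} {a : ℝ≥0∞} :
    (r : EReal) ≤ s + a ↔ ENNReal.ofReal (r - s) ≤ a := by
  rw [← EReal.coe_sub_le_coe_ennreal_iff, EReal.coe_sub,
    EReal.sub_le_iff_le_add (Or.inl (EReal.coe_ne_bot s)) (Or.inl (EReal.coe_ne_top s)), add_comm]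

theorem EReal.coe_add_coe_ennreal_le {r s : ℝ} {a : ℝ≥0∞} (h : s ≤ r)
    (ha : a ≤ ENNReal.ofReal (r - s)) : (s : EReal) + a ≤ r := by
  calc (s : EReal) + a ≤ s + (ENNReal.ofReal (r - s) : ℝ≥0∞) := by
        gcongr
        exact EReal.coe_ennreal_le_coe_ennreal_iff.2 ha
    _ = r := by
        rw [EReal.coe_ennreal_ofReal, max_eq_left (_root_.sub_nonneg.2 h), ← EReal.coe_add]
        simp

theorem EReal.coe_ennreal_iInf {ι : Sort*} (f : ι → ℝ≥0∞) :
    ((⨅ i, f i : ℝ≥0∞) : EReal) = ⨅ i, (f i : EReal) := by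
  refine le_antisymm (le_iInf fun i => EReal.coe_ennreal_le_coe_ennreal_iff.2 (iInf_le f i)) ?_
  rw [← EReal.coe_toENNReal (le_iInf fun i => EReal.coe_ennreal_nonneg (f i)),
    EReal.coe_ennreal_le_coe_ennreal_iff]
  refine le_iInf fun i => ?_
  rw [← EReal.coe_ennreal_le_coe_ennreal_iff,
    EReal.coe_toENNReal (le_iInf fun i => EReal.coe_ennreal_nonneg (f i))]
  exact iInf_le _ i

theorem IsPiecewiseC1OnIic.absolutelyContinuousOnInterval {γ : ℝ → ℝ} (hγ : IsPiecewiseC1OnIic γ)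
    {a : ℝ} (ha : a < 0) : AbsolutelyContinuousOnInterval γ a 0 := by
  obtain ⟨n, τ, h0, hn, hτ⟩ := hγ.2 a ha
  have key : ∀ i ≤ n, τ 0 ≤ τ i ∧ AbsolutelyContinuousOnInterval γ (τ 0) (τ i) := by
    intro i
    induction i with
    | zero =>
      refine fun _ => ⟨le_rfl, LipschitzOnWith.absolutelyContinuousOnInterval (K := 0) ?_⟩
      rw [uIcc_self]
      exact LipschitzOnWith.of_dist_le_mul fun s hs t ht => by simp_all
    | succ i ih =>
      intro hi
      obtain ⟨hle, hac⟩ := ih (by omega)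
      obtain ⟨hlt, hC⟩ := hτ i (by omega)
      exact ⟨hle.trans hlt.le, hac.trans hle hlt.le
        (ContDiffOn.absolutelyContinuousOnInterval (by rwa [uIcc_of_le hlt.le]))⟩
  simpa [h0, hn] using (key n le_rfl).2

variable {w : UnitAddCircle → ℝ}

theorem IsWeakKAMSolution.ofReal_sub_le (hw : IsWeakKAMSolution U w) {T : ℝ} (hT : 0 ≤ T)
    (y q : UnitAddCircle) : ENNReal.ofReal (w y - w q) ≤ leastAction U T y q := by
  refine le_leastAction fun γ hγ hq hy => ?_
  rw [← EReal.coe_sub_le_coe_ennreal_iff, ← hq, ← hy]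
  exact hw.dominated γ 0 T hT hγ

theorem IsWeakKAMSolution.ofReal_sub_le_peierlsBarrier (hw : IsWeakKAMSolution U w)
    (y q : UnitAddCircle) : ENNReal.ofReal (w y - w q) ≤ peierlsBarrier U y q := by
  refine le_peierlsBarrier_of_eventually ?_
  filter_upwards [eventually_ge_atTop 0] with T hT using hw.ofReal_sub_le hT y q

/-- A backward calibrated curve, described by the least action between its points. -/
theorem IsWeakKAMSolution.exists_calibrated (hper : Function.Periodic (deriv U) 1)
    (hw : IsWeakKAMSolution U w) (y : UnitAddCircle) :
    ∃ c : ℝ → UnitAddCircle, c 0 = y ∧ ∀ s t, 0 ≤ s → s ≤ t →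
      w (c t) ≤ w (c s) ∧ leastAction U (t - s) (c s) (c t) ≤ ENNReal.ofReal (w (c s) - w (c t)) := by
  obtain ⟨γ, h0, hC, hcal⟩ := hw.calibrated y
  refine ⟨fun t => (γ (-t) : UnitAddCircle), by simpa using h0, fun s t hs hst => ?_⟩
  rcases hst.eq_or_lt with rfl | hlt
  · refine ⟨le_rfl, ?_⟩
    have h := leastAction_le_action hper (U := U) (fun _ => γ (-s)) (a := 0) (b := 0)
      (ContDiffOn.absolutelyContinuousOnInterval (by fun_prop))
    simpa [action] using h
  have heq := hcal (-t) (-s) (by linarith) (by linarith)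
  have hle : w (γ (-t)) ≤ w (γ (-s)) := by
    have : (0 : EReal) ≤ ((w (γ (-s)) - w (γ (-t)) : ℝ) : EReal) := heq ▸ EReal.coe_ennreal_nonneg _
    rw [EReal.coe_nonneg] at this
    linarith
  refine ⟨hle, ?_⟩
  have hact : action U γ (-t) (-s) = ENNReal.ofReal (w (γ (-s)) - w (γ (-t))) := by
    rw [← EReal.coe_ennreal_eq_coe_ennreal_iff, ← heq, EReal.coe_ennreal_ofReal,
      max_eq_left (by linarith)]
  have hac : AbsolutelyContinuousOnInterval γ (-t) (-s) := by
    refine (hC.absolutelyContinuousOnInterval (a := -t) (by linarith)).mono ?_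
    rw [uIcc_of_le (by linarith), uIcc_of_le (by linarith)]
    exact Icc_subset_Icc_right (by linarith)
  have h := leastAction_le_action (U := U) hper γ hac
  rwa [hact, show -s - -t = t - s by ring] at h

theorem IsWeakKAMSolution.laxOleinik_eq (hper : Function.Periodic (deriv U) 1)
    (hw : IsWeakKAMSolution U w) {t : ℝ} (ht : 0 ≤ t) (y : UnitAddCircle) :
    laxOleinik U t (fun q => (w q : EReal)) y = w y := by
  refine le_antisymm ?_ (le_iInf fun q => EReal.coe_le_coe_add_coe_ennreal_iff.2
    (hw.ofReal_sub_le ht y q))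
  obtain ⟨c, rfl, hc⟩ := hw.exists_calibrated hper y
  obtain ⟨hle, h⟩ := hc 0 t le_rfl ht
  rw [sub_zero] at h
  exact iInf_le_of_le (c t) (EReal.coe_add_coe_ennreal_le hle h)

theorem manePotential_self (y : UnitAddCircle) : manePotential U y y = 0 := by
  obtain ⟨p, rfl⟩ := QuotientAddGroup.mk_surjective y
  refine le_antisymm (iInf₂_le_of_le 0 le_rfl ?_) bot_le
  have h := leastAction_le (U := U) (fun _ => p) (T := 0)
    (ContDiffOn.absolutelyContinuousOnInterval (by fun_prop))
  simpa [action] using h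

theorem IsWeakKAMSolution.eq_iInf_manePotential (hw : IsWeakKAMSolution U w) (y : UnitAddCircle) :
    (w y : EReal) = ⨅ q : UnitAddCircle, ((w q : EReal) + (manePotential U y q : EReal)) := by
  refine le_antisymm (le_iInf fun q => EReal.coe_le_coe_add_coe_ennreal_iff.2
    (le_iInf₂ fun T hT => hw.ofReal_sub_le hT y q)) (iInf_le_of_le y ?_)
  simp [manePotential_self]

/-- A limit point of a backward calibrated curve ending at `y` lies in the Aubry set and realizes
the value of a weak KAM solution at `y`. -/
theorem IsWeakKAMSolution.exists_mem_projectedAubrySet (hU : IsSkewPeriodicPotential U)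
    (hw : IsWeakKAMSolution U w) (y : UnitAddCircle) :
    ∃ q ∈ projectedAubrySet U, w q ≤ w y ∧ peierlsBarrier U y q ≤ ENNReal.ofReal (w y - w q) := by
  have hper := hU.periodic_deriv
  obtain ⟨M, -, hM⟩ := hU.exists_bound
  obtain ⟨c, rfl, hc⟩ := hw.exists_calibrated hper y
  -- An α-limit point of the calibrated curve, obtained from integer times by compactness of the
  -- circle.
  obtain ⟨q, -, φ, hφ, hlim⟩ := isCompact_univ.tendsto_subseq (x := fun n : ℕ => c n)
    (fun _ => mem_univ _)
  have hφt : Tendsto (fun n => (φ n : ℝ)) atTop atTop :=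
    tendsto_natCast_atTop_atTop.comp hφ.tendsto_atTop
  have hwlim : Tendsto (fun n => w (c (φ n))) atTop (nhds (w q)) :=
    (hw.continuous.tendsto q).comp hlim
  set K : ℝ≥0∞ := ENNReal.ofReal ((1 + M) ^ 2 / 4) with hK
  have hKlim : ∀ d : ℕ → ℝ, Tendsto d atTop (nhds 0) →
      Tendsto (fun n => K * ENNReal.ofReal (d n)) atTop (nhds 0) := fun d hd => by
    simpa using ENNReal.Tendsto.const_mul (ENNReal.tendsto_ofReal hd) (a := K)
      (Or.inr ENNReal.ofReal_ne_top)
  have hd : Tendsto (fun n => ‖c (φ n) - q‖) atTop (nhds 0) :=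
    (tendsto_iff_norm_sub_tendsto_zero.1 hlim)
  have hd' : Tendsto (fun n => ‖q - c (φ n)‖) atTop (nhds 0) := by
    simpa only [norm_sub_rev] using hd
  have hcurve : ∀ s, 0 ≤ s → w q ≤ w (c s) ∧
      peierlsBarrier U (c s) q ≤ ENNReal.ofReal (w (c s) - w q) := by
    intro s hs
    refine ⟨le_of_tendsto hwlim ?_, ?_⟩
    · filter_upwards [hφt.eventually_ge_atTop s] with n hn using (hc s _ hs hn).1
    have hbound : Tendsto (fun n => K * ENNReal.ofReal ‖c (φ n) - q‖ +
        ENNReal.ofReal (w (c s) - w (c (φ n)))) atTop (nhds (ENNReal.ofReal (w (c s) - w q))) := by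
      simpa using (hKlim _ hd).add (ENNReal.tendsto_ofReal (hwlim.const_sub (w (c s))))
    refine le_of_forall_gt fun r hr => ?_
    obtain ⟨r', hr₁, hr₂⟩ := exists_between hr
    refine lt_of_le_of_lt (peierlsBarrier_le_of_frequently ?_) hr₂
    -- A competitor from `q` to `c s`: a short arc from `q` to `c (φ n)`, then the calibrated curve.
    -- Its duration tends to infinity, as the liminf requires.
    have htime : Tendsto (fun n => ‖c (φ n) - q‖ + (φ n - s)) atTop atTop :=
      hd.add_atTop (tendsto_atTop_add_const_right _ _ hφt)
    refine htime.frequently (Eventually.frequently ?_)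
    filter_upwards [hbound.eventually_lt_const hr₁, hφt.eventually_ge_atTop s] with n hn hns
    exact ((leastAction_triangle hper (norm_nonneg _) (sub_nonneg.2 hns) _ _ _).trans
      (add_le_add (leastAction_norm_sub_le hM _ _) (hc s _ hs hns).2)).trans hn.le
  refine ⟨q, ?_, hcurve 0 le_rfl⟩
  -- The loop at `q` is closed by going to `c (φ n)` at barrier cost and returning by a short arc;
  -- both costs vanish in the limit.
  have hbound : Tendsto (fun n => ENNReal.ofReal (w (c (φ n)) - w q) +
      K * ENNReal.ofReal ‖q - c (φ n)‖) atTop (nhds 0) := by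
    simpa using (ENNReal.tendsto_ofReal (hwlim.sub_const (w q))).add (hKlim _ hd')
  refine le_antisymm (ge_of_tendsto' hbound fun n => ?_) bot_le
  exact (peierlsBarrier_triangle hper (norm_nonneg _) q (c (φ n)) q).trans
    (add_le_add (hcurve _ (Nat.cast_nonneg _)).2 (leastAction_norm_sub_le hM _ _))

theorem IsWeakKAMSolution.eq_iInf_peierlsBarrier (hU : IsSkewPeriodicPotential U)
    (hw : IsWeakKAMSolution U w) (y : UnitAddCircle) :
    (w y : EReal) =
      ⨅ q ∈ projectedAubrySet U, ((w q : EReal) + (peierlsBarrier U y q : EReal)) := by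
  refine le_antisymm (le_iInf₂ fun q _ => EReal.coe_le_coe_add_coe_ennreal_iff.2
    (hw.ofReal_sub_le_peierlsBarrier y q)) ?_
  obtain ⟨q, hq, hle, h⟩ := hw.exists_mem_projectedAubrySet hU y
  exact iInf₂_le_of_le q hq (EReal.coe_add_coe_ennreal_le hle h)

end Barrier

/-! ### Invariance and finiteness of the Freidlin–Wentzell function. -/

section FreidlinWentzell

variable {U : ℝ → ℝ}

/-- A minimum of Peierls barriers issuing from critical points is invariant under the
Lax–Oleinik semigroup, whatever constants are added to them. -/
theorem freidlinWentzell_invariant (hper : Function.Periodic (deriv U) 1) {k : ℕ} {x : ℤ → ℝ}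
    (hx : ∀ i, deriv U (x i) = 0) {t : ℝ} (ht : 0 ≤ t) (y : UnitAddCircle) :
    laxOleinik U t (fun q => (freidlinWentzell U k x q : EReal)) y = freidlinWentzell U k x y := by
  apply le_antisymm
  -- Bounding each long curve separately avoids any need for minimizers.
  · suffices h : ∀ j ∈ Icc (1 : ℤ) k, ∀ T, t ≤ T → ∀ γ : ℝ → ℝ,
        AbsolutelyContinuousOnInterval γ 0 T → (γ 0 : UnitAddCircle) = x j →
        (γ T : UnitAddCircle) = y →
        ⨅ q, (freidlinWentzell U k x q + leastAction U t y q) ≤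
          boundaryValue U k x j + action U γ 0 T by
      have h' : ⨅ q, (freidlinWentzell U k x q + leastAction U t y q) ≤
          freidlinWentzell U k x y := by
        refine le_iInf₂ fun j hj => ?_
        rw [← tsub_le_iff_left]
        refine le_peierlsBarrier_of_eventually ?_
        filter_upwards [eventually_ge_atTop t] with T hT
        refine le_leastAction fun γ hγ h0 hT' => ?_
        rw [tsub_le_iff_left]
        exact h j hj T hT γ hγ h0 hT'
      refine le_trans ?_ (EReal.coe_ennreal_le_coe_ennreal_iff.2 h')
      rw [EReal.coe_ennreal_iInf]
      simp only [EReal.coe_ennreal_add]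
      exact le_rfl
    intro j hj T hT γ hγ h0 hy
    have h0T : 0 ≤ T := ht.trans hT
    have hac₁ : AbsolutelyContinuousOnInterval γ 0 (T - t) := by
      refine hγ.mono ?_
      rw [uIcc_of_le (by linarith), uIcc_of_le h0T]
      exact Icc_subset_Icc_right (by linarith)
    have hac₂ : AbsolutelyContinuousOnInterval γ (T - t) T := by
      refine hγ.mono ?_
      rw [uIcc_of_le (by linarith), uIcc_of_le h0T]
      exact Icc_subset_Icc_left (by linarith)
    have h₁ : peierlsBarrier U (γ (T - t)) (x j) ≤ action U γ 0 (T - t) :=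
      (peierlsBarrier_le_leastAction hper (hx j) (sub_nonneg.2 hT) _).trans
        (h0 ▸ leastAction_le γ hac₁)
    have h₂ : leastAction U t y (γ (T - t)) ≤ action U γ (T - t) T := by
      simpa [hy] using leastAction_le_action hper (U := U) γ hac₂
    -- The curve is cut so that its last piece lasts exactly `t`; the first piece, issuing from a
    -- critical point, bounds the barrier.
    refine iInf_le_of_le (γ (T - t) : UnitAddCircle) ?_
    rw [action_add γ (sub_nonneg.2 hT) (by linarith : T - t ≤ T), ← add_assoc]
    exact add_le_add (iInf₂_le_of_le j hj (by gcongr)) h₂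
  · refine le_iInf fun q => ?_
    rw [← EReal.coe_ennreal_add, EReal.coe_ennreal_le_coe_ennreal_iff]
    simp only [freidlinWentzell, ENNReal.iInf_add]
    refine le_iInf₂ fun j hj => iInf₂_le_of_le j hj ?_
    rw [add_assoc]
    gcongr
    exact peierlsBarrier_triangle hper ht _ _ _

theorem freidlinWentzell_ne_top (hU : IsSkewPeriodicPotential U) {k : ℕ} (hk : 0 < k) {x : ℤ → ℝ}
    (hx : ∀ i, deriv U (x i) = 0) (y : UnitAddCircle) : freidlinWentzell U k x y ≠ ⊤ := by
  obtain ⟨M, -, hM⟩ := hU.exists_bound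
  have h1 : (1 : ℤ) ∈ Icc (1 : ℤ) k := ⟨le_rfl, by exact_mod_cast hk⟩
  have hR : costRight U k x 1 1 ≠ ⊤ := by
    rw [costRight]; split_ifs <;> exact lineBarrier_ne_top hM _ _
  have hL : costLeft U k x 1 1 ≠ ⊤ := by
    rw [costLeft]; split_ifs <;> exact lineBarrier_ne_top hM _ _
  have hW : boundaryValue U k x 1 ≠ ⊤ :=
    ne_top_of_le_ne_top (ENNReal.add_ne_top.2 ⟨hR, hL⟩) (iInf₂_le (1 : ℤ) h1)
  have hh : peierlsBarrier U y (x 1) ≠ ⊤ :=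
    ne_top_of_le_ne_top (leastAction_one_ne_top hM _ _)
      (peierlsBarrier_le_leastAction hU.periodic_deriv (hx 1) zero_le_one y)
  exact ne_top_of_le_ne_top (ENNReal.add_ne_top.2 ⟨hW, hh⟩) (iInf₂_le (1 : ℤ) h1)

end FreidlinWentzell

/-! ### Identification of the Aubry set by a strict subsolution. -/

section Aubry

variable {U : ℝ → ℝ}

/-- A potential with interleaved critical points increases somewhere and decreases somewhere. -/
theorem HasInterleavedCriticalPoints.exists_deriv_pos_and_neg (hU : IsSkewPeriodicPotential U)
    {k : ℕ} {x z : ℤ → ℝ} (hcrit : HasInterleavedCriticalPoints U k x z) :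
    (∃ p, 0 < deriv U p) ∧ ∃ p, deriv U p < 0 := by
  have hdiff : Differentiable ℝ U := hU.1.differentiable (by simp)
  have hx : StrictMono x := strictMono_int_of_lt_succ fun i =>
    (hcrit.x_lt_z i).trans (hcrit.z_lt_x i)
  have hz : StrictMono z := strictMono_int_of_lt_succ fun i =>
    (hcrit.z_lt_x i).trans (hcrit.x_lt_z (i + 1))
  have hne₁ : ∀ p ∈ Ioo (x 0) (z 0), deriv U p ≠ 0 := by
    rintro p ⟨hp₁, hp₂⟩ h0
    rcases (hcrit.critical_iff p).1 h0 with ⟨i, rfl⟩ | ⟨i, rfl⟩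
    · have h1 := hx.lt_iff_lt.1 hp₁
      have h2 := hx.lt_iff_lt.1 (hp₂.trans (hcrit.z_lt_x 0))
      omega
    · have h2 := hz.lt_iff_lt.1 hp₂
      have h1 := hz.lt_iff_lt.1 ((by simpa using hcrit.z_lt_x (-1) : z (-1) < x 0).trans hp₁)
      omega
  have hne₂ : ∀ p ∈ Ioo (z (-1)) (x 0), deriv U p ≠ 0 := by
    rintro p ⟨hp₁, hp₂⟩ h0
    rcases (hcrit.critical_iff p).1 h0 with ⟨i, rfl⟩ | ⟨i, rfl⟩
    · have h2 := hx.lt_iff_lt.1 hp₂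
      have h1 := hx.lt_iff_lt.1 ((hcrit.x_lt_z (-1)).trans hp₁)
      omega
    · have h1 := hz.lt_iff_lt.1 hp₁
      have h2 := hz.lt_iff_lt.1 (hp₂.trans (hcrit.x_lt_z 0))
      omega
  have hmin := hcrit.isLocalMin 0
  constructor
  · have hev : ∀ᶠ p in nhdsWithin (x 0) (Ioi (x 0)), U (x 0) ≤ U p ∧ p ∈ Ioo (x 0) (z 0) :=
      (hmin.filter_mono nhdsWithin_le_nhds).and (Ioo_mem_nhdsGT (hcrit.x_lt_z 0))
    obtain ⟨p, hle, hp⟩ := hev.exists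
    obtain ⟨c, hc, hslope⟩ := exists_deriv_eq_slope U hp.1 hdiff.continuous.continuousOn
      hdiff.differentiableOn
    -- The local minimum gives a nonnegative slope, and the absence of critical points in the gap
    -- makes it positive.
    refine ⟨c, lt_of_le_of_ne ?_ (hne₁ c ⟨hc.1, hc.2.trans hp.2⟩).symm⟩
    rw [hslope]
    exact div_nonneg (sub_nonneg.2 hle) (sub_nonneg.2 hp.1.le)
  · have hz0 : z (-1) < x 0 := by simpa using hcrit.z_lt_x (-1)
    have hev : ∀ᶠ p in nhdsWithin (x 0) (Iio (x 0)), U (x 0) ≤ U p ∧ p ∈ Ioo (z (-1)) (x 0) :=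
      (hmin.filter_mono nhdsWithin_le_nhds).and (Ioo_mem_nhdsLT hz0)
    obtain ⟨p, hle, hp⟩ := hev.exists
    obtain ⟨c, hc, hslope⟩ := exists_deriv_eq_slope U hp.2 hdiff.continuous.continuousOn
      hdiff.differentiableOn
    refine ⟨c, lt_of_le_of_ne ?_ (hne₂ c ⟨hp.1.trans hc.1, hc.2⟩)⟩
    rw [hslope]
    exact div_nonpos_of_nonpos_of_nonneg (sub_nonpos.2 hle) (sub_nonneg.2 hp.2.le)

theorem Function.Periodic.intervalIntegral_pos {f : ℝ → ℝ} (hper : Function.Periodic f 1)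
    (hf : Continuous f) (h0 : ∀ p, 0 ≤ f p) (hpos : ∃ p, 0 < f p) : 0 < ∫ p in (0 : ℝ)..1, f p := by
  obtain ⟨p, hp⟩ := hpos
  obtain ⟨q, hq, h⟩ := hper.exists_mem_Ico₀ one_pos p
  exact intervalIntegral.integral_pos one_pos hf.continuousOn (fun t _ => h0 t)
    ⟨q, ⟨hq.1, hq.2.le⟩, h ▸ hp⟩

/-- A `C¹` periodic subsolution `φ` (with derivative `ψ`) of the Hamilton–Jacobi equation, strict
away from the zeros of `F = U'`. -/
theorem exists_strict_subsolution {F : ℝ → ℝ} (hF : Continuous F) (hper : Function.Periodic F 1)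
    (hpos : ∃ p, 0 < F p) (hneg : ∃ p, F p < 0) :
    ∃ φ ψ : ℝ → ℝ, Continuous ψ ∧ Function.Periodic ψ 1 ∧ Function.Periodic φ 1 ∧
      (∀ p, HasDerivAt φ (ψ p) p) ∧ (∀ p, 0 ≤ ψ p * (F p - ψ p)) ∧
      ∀ p, F p ≠ 0 → 0 < ψ p * (F p - ψ p) := by
  set A := ∫ p in (0 : ℝ)..1, max (F p) 0 with hA
  set B := ∫ p in (0 : ℝ)..1, max (-F p) 0 with hB
  have hApos : 0 < A := Function.Periodic.intervalIntegral_pos (fun p => by simp only [hper p])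
    (by fun_prop) (fun p => le_max_right _ _) (hpos.imp fun p hp => lt_max_of_lt_left hp)
  have hBpos : 0 < B := Function.Periodic.intervalIntegral_pos (fun p => by simp only [hper p])
    (by fun_prop) (fun p => le_max_right _ _)
    (hneg.imp fun p hp => lt_max_of_lt_left (neg_pos.2 hp))
  -- The weights solve `s A = t B` and `s + t = 1`: `ψ` then has mean zero, and equals `F` times a
  -- factor in `(0, 1)`.
  set s := B / (A + B) with hs
  set t := A / (A + B) with ht
  have hs0 : 0 < s := by positivity
  have ht0 : 0 < t := by positivity
  have hst : s + t = 1 := by rw [hs, ht]; field_simp; ring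
  set ψ : ℝ → ℝ := fun p => s * max (F p) 0 - t * max (-F p) 0 with hψ
  have hψc : Continuous ψ := by fun_prop
  have hψper : Function.Periodic ψ 1 := fun p => by simp only [hψ, hper p]
  have hψint : ∫ p in (0 : ℝ)..1, ψ p = 0 := by
    rw [intervalIntegral.integral_sub (Continuous.intervalIntegrable (by fun_prop) _ _)
      (Continuous.intervalIntegrable (by fun_prop) _ _), intervalIntegral.integral_const_mul,
      intervalIntegral.integral_const_mul, ← hA, ← hB, hs, ht]
    field_simp
    ring
  have hstrict : ∀ p, F p ≠ 0 → 0 < ψ p * (F p - ψ p) := by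
    intro p hp
    rcases hp.lt_or_gt with h | h
    · have : ψ p = t * F p := by
        simp only [hψ, max_eq_right h.le, max_eq_left (neg_pos.2 h).le]
        ring
      rw [this, show t * F p * (F p - t * F p) = t * (1 - t) * (F p * F p) by ring]
      exact mul_pos (mul_pos ht0 (by linarith)) (mul_pos_of_neg_of_neg h h)
    · have : ψ p = s * F p := by
        simp only [hψ, max_eq_left h.le, max_eq_right (neg_lt_zero.2 h).le]
        ring
      rw [this, show s * F p * (F p - s * F p) = s * (1 - s) * (F p * F p) by ring]
      exact mul_pos (mul_pos hs0 (by linarith)) (mul_pos h h)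
  refine ⟨fun p => ∫ q in (0 : ℝ)..p, ψ q, ψ, hψc, hψper, fun p => ?_,
    fun p => (hψc.integral_hasStrictDerivAt 0 p).hasDerivAt, fun p => ?_, hstrict⟩
  · have h := hψper.intervalIntegral_add_eq p 0
    rw [zero_add, hψint] at h
    simp only
    rw [← intervalIntegral.integral_add_adjacent_intervals (hψc.intervalIntegrable 0 p)
      (hψc.intervalIntegrable p (p + 1)), h, add_zero]
  · rcases eq_or_ne (F p) 0 with h | h
    · simp [hψ, h]
    · exact (hstrict p h).le

/-- The action of a curve is at least the increment of a `C¹` subsolution plus the integral of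
its defect. -/
theorem ofReal_sub_add_integral_le_action (hU : IsSkewPeriodicPotential U) {φ ψ : ℝ → ℝ}
    (hψ : Continuous ψ) (hψper : Function.Periodic ψ 1) (hφ : ∀ p, HasDerivAt φ (ψ p) p)
    {γ : ℝ → ℝ} {T : ℝ} (hT : 0 ≤ T) (hγ : AbsolutelyContinuousOnInterval γ 0 T) :
    ENNReal.ofReal (φ (γ T) - φ (γ 0) +
      ∫ t in (0 : ℝ)..T, ψ (γ t) * (deriv U (γ t) - ψ (γ t))) ≤ action U γ 0 T := by
  obtain ⟨C, hC⟩ : ∃ C : NNReal, ∀ p, ‖ψ p‖₊ ≤ C := by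
    obtain ⟨C, hC⟩ := isCompact_Icc.exists_bound_of_continuousOn (s := Icc (0 : ℝ) 1)
      hψ.continuousOn
    refine ⟨⟨C, (norm_nonneg _).trans (hC 0 (by simp))⟩, fun p => ?_⟩
    obtain ⟨q, hq, h⟩ := hψper.exists_mem_Ico₀ one_pos p
    rw [h]
    exact hC q ⟨hq.1, hq.2.le⟩
  have hlip : LipschitzWith C φ := lipschitzWith_of_nnnorm_deriv_le
    (fun p => (hφ p).differentiableAt) fun p => by rw [(hφ p).deriv]; exact hC p
  have hac := hlip.comp_absolutelyContinuousOnInterval hγ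
  have hψγ : ContinuousOn (fun t => ψ (γ t)) (uIcc 0 T) := hψ.comp_continuousOn hγ.continuousOn
  have hUγ : ContinuousOn (fun t => deriv U (γ t)) (uIcc 0 T) :=
    hU.continuous_deriv.comp_continuousOn hγ.continuousOn
  have hi₁ : IntervalIntegrable (fun t => ψ (γ t) * deriv γ t) volume 0 T :=
    hγ.intervalIntegrable_deriv.continuousOn_mul hψγ
  have hi₂ : IntervalIntegrable (fun t => ψ (γ t) * (deriv U (γ t) - ψ (γ t))) volume 0 T :=
    (hψγ.mul (hUγ.sub hψγ)).intervalIntegrable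
  have hFTC : ∫ t in (0 : ℝ)..T, ψ (γ t) * deriv γ t = φ (γ T) - φ (γ 0) := by
    rw [← hac.integral_deriv_eq_sub]
    refine intervalIntegral.integral_congr_ae ?_
    filter_upwards [hγ.ae_differentiableAt] with t ht htT
    exact ((hφ (γ t)).comp t (ht (uIoc_subset_uIcc htT)).hasDerivAt).deriv.symm
  have h := ofReal_integral_le_action (U := U) (γ := γ) hT (hi₁.add hi₂) fun t => by
    rw [lagrangian]
    -- The difference of the two sides is exactly a quarter of this square.
    nlinarith [sq_nonneg (deriv γ t + deriv U (γ t) - 2 * ψ (γ t))]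
  rwa [intervalIntegral.integral_add hi₁ hi₂, hFTC] at h

/-- A loop from `r` of action below `δ / 4` cannot leave the `δ`-ball around its starting point
before time `τ`. It therefore collects at least `τ * (g r / 2)` from the defect `g`, while the
increment of the periodic `φ` vanishes. -/
theorem peierlsBarrier_self_pos (hU : IsSkewPeriodicPotential U) (hpos : ∃ p, 0 < deriv U p)
    (hneg : ∃ p, deriv U p < 0) {r : ℝ} (hr : deriv U r ≠ 0) :
    0 < peierlsBarrier U (r : UnitAddCircle) r := by
  obtain ⟨M, hM0, hM⟩ := hU.exists_bound
  obtain ⟨φ, ψ, hψ, hψper, hφper, hφ, hg0, hg⟩ :=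
    exists_strict_subsolution hU.continuous_deriv hU.periodic_deriv hpos hneg
  set g : ℝ → ℝ := fun p => ψ p * (deriv U p - ψ p) with hgdef
  have hgc : Continuous g := hψ.mul (hU.continuous_deriv.sub hψ)
  have hgr : 0 < g r := hg r hr
  obtain ⟨δ, hδ, hball⟩ : ∃ δ > 0, ∀ p, |p - r| < δ → g r / 2 < g p :=
    Metric.eventually_nhds_iff.1 (hgc.continuousAt.eventually_const_lt (half_lt_self hgr))
  -- Chosen so that up to time `τ` the displacement stays below `δ / 4 + (1 + M) * τ = 3 δ / 4 < δ`.
  set τ := δ / (2 * (1 + M)) with hτ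
  have hτ0 : 0 < τ := by positivity
  have hMτ : (1 + M) * τ = δ / 2 := by rw [hτ]; field_simp
  refine lt_of_lt_of_le (b := ENNReal.ofReal (min (δ / 4) (τ * (g r / 2)))) 
    (ENNReal.ofReal_pos.2 (by positivity))
    (le_peierlsBarrier_of_eventually ?_)
  filter_upwards [eventually_ge_atTop τ] with T hT
  have hT0 : 0 ≤ T := hτ0.le.trans hT
  refine le_leastAction fun γ hγ h0 hT' => ?_
  by_contra! hlt
  have hclose : ∀ t ∈ Icc 0 τ, g r / 2 ≤ g (γ t) := by
    intro t ht
    obtain ⟨n, hn⟩ := exists_int_of_coe_eq h0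
    have hac : AbsolutelyContinuousOnInterval γ 0 t := by
      refine hγ.mono ?_
      rw [uIcc_of_le ht.1, uIcc_of_le hT0]
      exact Icc_subset_Icc_right (ht.2.trans hT)
    have h := ((ofReal_abs_sub_le_action hM ht.1 hac).trans
      (action_mono γ (ht.2.trans hT))).trans_lt hlt
    rw [ENNReal.ofReal_lt_ofReal_iff (by positivity)] at h
    have h1 : (1 + M) * t ≤ δ / 2 := hMτ ▸ mul_le_mul_of_nonneg_left ht.2 (by linarith)
    have h2 : |γ t - γ 0| < δ := by linarith [h.trans_le (min_le_left _ _)]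
    have hgper : g (γ t - n) = g (γ t) := by
      have hU' := hU.periodic_deriv.sub_int_mul_eq n (x := γ t)
      have hψ' := hψper.sub_int_mul_eq n (x := γ t)
      rw [mul_one] at hU' hψ'
      simp only [hgdef, hU', hψ']
    rw [← hgper]
    refine (hball _ ?_).le
    rwa [show γ t - n - r = γ t - γ 0 by rw [hn]; ring]
  have hφT : φ (γ T) = φ (γ 0) := by
    obtain ⟨n, hn⟩ := exists_int_of_coe_eq (hT'.trans h0.symm)
    rw [hn]
    simpa using hφper.int_mul n (γ 0)
  have hact := ofReal_sub_add_integral_le_action hU hψ hψper hφ hT0 hγ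
  rw [hφT, sub_self, zero_add] at hact
  have hgγ : ContinuousOn (fun t => g (γ t)) (Icc 0 T) := by
    rw [← uIcc_of_le hT0]
    exact hgc.comp_continuousOn hγ.continuousOn
  have hi₁ : IntervalIntegrable (fun t => g (γ t)) volume 0 τ :=
    (hgγ.mono (by rw [uIcc_of_le hτ0.le]; exact Icc_subset_Icc_right hT)).intervalIntegrable
  have hi₂ : IntervalIntegrable (fun t => g (γ t)) volume τ T :=
    (hgγ.mono (by rw [uIcc_of_le hT]; exact Icc_subset_Icc_left hτ0.le)).intervalIntegrable
  have hint : τ * (g r / 2) ≤ ∫ t in (0 : ℝ)..T, g (γ t) := by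
    rw [← intervalIntegral.integral_add_adjacent_intervals hi₁ hi₂]
    have h1 : ∫ _ in (0 : ℝ)..τ, g r / 2 ≤ ∫ t in (0 : ℝ)..τ, g (γ t) :=
      intervalIntegral.integral_mono_on hτ0.le intervalIntegrable_const hi₁ hclose
    have h2 : 0 ≤ ∫ t in τ..T, g (γ t) :=
      intervalIntegral.integral_nonneg hT fun t _ => hg0 (γ t)
    rw [intervalIntegral.integral_const, smul_eq_mul, sub_zero] at h1
    linarith
  exact (((ENNReal.ofReal_le_ofReal ((min_le_right _ _).trans hint)).trans hact).trans_lt hlt).false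

theorem projectedAubrySet_eq (hU : IsSkewPeriodicPotential U) (hpos : ∃ p, 0 < deriv U p)
    (hneg : ∃ p, deriv U p < 0) :
    projectedAubrySet U = {p : UnitAddCircle | ∃ r : ℝ, deriv U r = 0 ∧ p = r} := by
  ext p
  constructor
  · intro hp
    obtain ⟨r, rfl⟩ := QuotientAddGroup.mk_surjective p
    refine ⟨r, ?_, rfl⟩
    by_contra hr
    exact (peierlsBarrier_self_pos hU hpos hneg hr).ne' hp
  · rintro ⟨r, hr, rfl⟩
    refine le_antisymm ?_ bot_le
    exact (peierlsBarrier_le_leastAction hU.periodic_deriv hr le_rfl _).trans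
      (leastAction_self_eq_zero_of_deriv_eq_zero hr 0).le

end Aubry

theorem mainTheorem10 (U : ℝ → ℝ) (hU : IsSkewPeriodicPotential U)
    (k : ℕ) (x z : ℤ → ℝ) (hcrit : HasInterleavedCriticalPoints U k x z) :
    -- the projected Aubry set consists of the critical points of `U`
    projectedAubrySet U =
      {p : UnitAddCircle | (∃ i : ℤ, p = (x i : UnitAddCircle)) ∨
        ∃ i : ℤ, p = (z i : UnitAddCircle)} ∧
    -- every weak KAM solution is invariant, and has the two representations
    (∀ w : UnitAddCircle → ℝ, IsWeakKAMSolution U w →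
      (∀ t : ℝ, 0 ≤ t → ∀ y : UnitAddCircle,
        laxOleinik U t (fun q => (w q : EReal)) y = (w y : EReal)) ∧
      (∀ y : UnitAddCircle,
        (w y : EReal) = ⨅ q : UnitAddCircle, ((w q : EReal) + (manePotential U y q : EReal))) ∧
      (∀ y : UnitAddCircle,
        (w y : EReal) =
          ⨅ q ∈ projectedAubrySet U, ((w q : EReal) + (peierlsBarrier U y q : EReal)))) ∧
    -- the Freidlin–Wentzell function is finite and invariant
    (∀ y : UnitAddCircle, freidlinWentzell U k x y ≠ ⊤) ∧
    (∀ t : ℝ, 0 ≤ t → ∀ y : UnitAddCircle,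
      laxOleinik U t (fun q => (freidlinWentzell U k x q : EReal)) y =
        (freidlinWentzell U k x y : EReal)) := by
  have hx : ∀ i, deriv U (x i) = 0 := fun i => (hcrit.critical_iff _).2 (Or.inl ⟨i, rfl⟩)
  have hper := hU.periodic_deriv
  obtain ⟨hpos, hneg⟩ := hcrit.exists_deriv_pos_and_neg hU
  refine ⟨?_, fun w hw => ⟨fun t ht y => hw.laxOleinik_eq hper ht y, hw.eq_iInf_manePotential,
    hw.eq_iInf_peierlsBarrier hU⟩, freidlinWentzell_ne_top hU hcrit.pos hx,
    fun t ht y => freidlinWentzell_invariant hper hx ht y⟩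
  rw [projectedAubrySet_eq hU hpos hneg]
  ext p
  simp only [mem_ofPred_eq, hcrit.critical_iff]
  constructor
  · rintro ⟨r, ⟨i, rfl⟩ | ⟨i, rfl⟩, rfl⟩
    exacts [Or.inl ⟨i, rfl⟩, Or.inr ⟨i, rfl⟩]
  · rintro (⟨i, rfl⟩ | ⟨i, rfl⟩)
    exacts [⟨_, Or.inl ⟨i, rfl⟩, rfl⟩, ⟨_, Or.inr ⟨i, rfl⟩, rfl⟩]
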